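/- Let $\{S(t):t\ge 0\}$ be a real-valued Lévy process such that $\kappa_S(\theta):=\log\mathbb{E}[e^{\theta S(1)}]$ is finite in a neighborhood of $\theta=0$, and put $m:=\kappa_S'(0)$ and $q:=\kappa_S''(0)$. Let $\nu\in(0,1)$, and let $\{L_\nu(t):t\ge 0\}$ be an inverse of a $\nu$-stable subordinator, that is, $L_\nu(t)=\inf\{s\ge 0: D(s)>t\}$, where $\{D(s):s\ge 0\}$ is a nondecreasing Lévy process with $\mathbb{E}[e^{-\xi D(s)}]=e^{-s\xi^\nu}$ for all $\xi,s\ge 0$. Assume that the processes $\{S(t):t\ge 0\}$ and $\{L_\nu(t):t\ge 0\}$ are independent. Let $\alpha(\nu):=1-\nu/2$ if $m=0$, and $\alpha(\nu):=1-\nu$ if $m\ne 0$. Then, as $t\to\infty$: * if $m=0$, then $t^{\alpha(\nu)}\,\frac{S(L_\nu(t))}{t}$ converges weakly (in distribution) to $\sqrt{q\,L_\nu(1)}\,Z$, where $Z$ is a standard normal random variable independent of $L_\nu(1)$; * if $m\ne 0$, then $t^{\alpha(\nu)}\,\frac{S(L_\nu(t))}{t}$ converges weakly (in distribution) to $m\,L_\nu(1)$.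 -/

import Mathlib

open MeasureTheory ProbabilityTheory Filter Topology Set
open scoped NNReal

/-- A function on `[0, ∞)` is càdlàg if it is right-continuous and has left limits everywhere. -/
def IsCadlag (f : ℝ≥0 → ℝ) : Prop :=
  ∀ t : ℝ≥0, ContinuousWithinAt f (Ici t) t ∧ ∃ l : ℝ, Tendsto f (𝓝[<] t) (𝓝 l)

/-- Real-valued Lévy processes: processes started at `0`, with independent and stationary
increments and almost surely càdlàg paths. -/
structure IsLevyProcess {Ω : Type*} [MeasurableSpace Ω] (X : ℝ≥0 → Ω → ℝ) (P : Measure Ω) :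
    Prop where
  measurable : ∀ t, Measurable (X t)
  zero : ∀ᵐ ω ∂P, X 0 ω = 0
  indepIncrements : HasIndepIncrements X P
  stationaryIncrements : ∀ s t : ℝ≥0, IdentDistrib (fun ω ↦ X (s + t) ω - X s ω) (X t) P P
  cadlag : ∀ᵐ ω ∂P, IsCadlag fun t ↦ X t ω

/-- A subordinator is a nondecreasing Lévy process. -/
structure IsSubordinator {Ω : Type*} [MeasurableSpace Ω] (D : ℝ≥0 → Ω → ℝ) (P : Measure Ω) :
    Prop extends IsLevyProcess D P where
  monotone : ∀ᵐ ω ∂P, Monotone fun t ↦ D t ω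

/-- The `ν`-stable subordinator: `𝔼[exp (-ξ D(t))] = exp (-t ξ ^ ν)` for all `ξ, t ≥ 0`. -/
structure IsStableSubordinator {Ω : Type*} [MeasurableSpace Ω] (ν : ℝ) (D : ℝ≥0 → Ω → ℝ)
    (P : Measure Ω) : Prop extends IsSubordinator D P where
  laplace : ∀ t ξ : ℝ≥0, mgf (D t) P (-(ξ : ℝ)) = Real.exp (-((t : ℝ) * (ξ : ℝ) ^ ν))

/-- `L` is an inverse of a `ν`-stable subordinator, that is the first passage time process
`L(t) = inf {s ≥ 0 : D(s) > t}` of a `ν`-stable subordinator `D`. Almost surely `D` is unbounded,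
so that the infimum is taken over a nonempty set. -/
def IsInverseStableSubordinator {Ω : Type*} [MeasurableSpace Ω] (ν : ℝ) (L : ℝ≥0 → Ω → ℝ≥0)
    (P : Measure Ω) : Prop :=
  ∃ D : ℝ≥0 → Ω → ℝ, IsStableSubordinator ν D P ∧
    ∀ᵐ ω ∂P, ∀ t : ℝ≥0, L t ω = sInf {s : ℝ≥0 | (t : ℝ) < D s ω}

open Classical in
/-- The exponent `α(ν)`: it is `1 - ν / 2` if `m = 0`, and `1 - ν` if `m ≠ 0`. -/
noncomputable def scalingExponent (ν m : ℝ) : ℝ :=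
  if m = 0 then 1 - ν / 2 else 1 - ν

/-!
The characteristic function `φ_s` of a Lévy process `S` at time `s` is multiplicative in `s`, so at
a large time it is, up to the negligible contribution of the fractional part, a high power of
`φ_1`. The second order expansion of `φ_1` at `0`, available because exponential moments near the
origin give a second moment, yields the central limit theorem for `S` when the mean `m` vanishes
and the law of large numbers otherwise
(`IsLevyProcess.tendsto_charFun_map_of_integral_eq_zero`,
`IsLevyProcess.tendsto_charFun_map_of_memLp_two`).

The inverse `L` of a `ν`-stable subordinator is self-similar: `L t` has the law of `t ^ ν * L 1`
(`IsInverseStableSubordinator.map_eq_map_mul`). This is inherited from the self-similarity of the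
subordinator, which follows from its Laplace transform, because the events `L t < x` and `t < D x`
agree up to the boundary.

By independence, the characteristic function of `S (L t)` is the mixture of the `φ_s` over the law
of `L t` (`IsLevyProcess.charFun_map_eval`), that is, the mixture of the `φ_(t ^ ν * s)` over the
law of `L 1`. With the scaling `t ^ (α(ν) - 1)`, which is `t ^ (-ν / 2)` or `t ^ (-ν)`, the
integrand converges for each `s` by the limit theorems for `S`, hence so does the integral by
dominated convergence (`tendstoInDistribution_eval_inverseStableSubordinator`). The limit is the
characteristic function of the claimed variable, and Lévy's continuity theorem concludes.
-/

/-! ### Characteristic functions of a Lévy process at large times -/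

section

/-- Each point has a one-sided neighbourhood on the left and one on the right on which the function
is bounded; compactness does the rest. -/
lemma IsCadlag.exists_abs_le {f : ℝ≥0 → ℝ} (hf : IsCadlag f) (b : ℝ≥0) :
    ∃ C : ℝ, ∀ t ≤ b, |f t| ≤ C := by
  suffices h : ∃ C : ℝ, ∀ t ∈ Icc 0 b, |f t| ≤ C by
    obtain ⟨C, hC⟩ := h
    exact ⟨C, fun t ht ↦ hC t ⟨zero_le, ht⟩⟩
  refine isCompact_Icc.induction_on (p := fun s ↦ ∃ C : ℝ, ∀ t ∈ s, |f t| ≤ C)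
    ⟨0, by simp⟩ (fun s t hst ⟨C, hC⟩ ↦ ⟨C, fun x hx ↦ hC x (hst hx)⟩) ?_ ?_
  · rintro s t ⟨C, hC⟩ ⟨C', hC'⟩
    refine ⟨max C C', fun x hx ↦ hx.elim (fun h ↦ (hC x h).trans (le_max_left _ _))
      fun h ↦ (hC' x h).trans (le_max_right _ _)⟩
  · intro x _
    obtain ⟨h1, l, h2⟩ := hf x
    have e1 : ∀ᶠ y in 𝓝[≥] x, |f y| ≤ |f x| + 1 :=
      (h1.tendsto.abs.eventually (gt_mem_nhds (lt_add_one _))).mono fun _ h ↦ h.le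
    have e2 : ∀ᶠ y in 𝓝[<] x, |f y| ≤ |l| + 1 :=
      (h2.abs.eventually (gt_mem_nhds (lt_add_one _))).mono fun _ h ↦ h.le
    have e3 : ∀ᶠ y in 𝓝 x, |f y| ≤ max (|f x| + 1) (|l| + 1) := by
      rw [← nhdsLT_sup_nhdsGE x, eventually_sup]
      exact ⟨e2.mono fun y hy ↦ hy.trans (le_max_right _ _),
        e1.mono fun y hy ↦ hy.trans (le_max_left _ _)⟩
    exact ⟨_, mem_nhdsWithin_of_mem_nhds e3, _, fun y hy ↦ hy⟩

/-- A form of `Complex.tendsto_one_add_pow_exp_of_tendsto` in which the exponent is an arbitrary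
sequence tending to infinity; it follows from `log z = z - 1 + o(z - 1)` at `1`. -/
lemma tendsto_pow_exp_of_tendsto_mul_sub_one {n : ℕ → ℕ} {z : ℕ → ℂ} {c : ℂ}
    (hn : Tendsto n atTop atTop) (hz : Tendsto (fun k ↦ (n k : ℂ) * (z k - 1)) atTop (𝓝 c)) :
    Tendsto (fun k ↦ z k ^ n k) atTop (𝓝 (Complex.exp c)) := by
  have hn' : Tendsto (fun k ↦ ((n k : ℂ))⁻¹) atTop (𝓝 0) :=
    (tendsto_inv_atTop_nhds_zero_nat (𝕜 := ℂ)).comp hn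
  have hz0 : Tendsto (fun k ↦ z k - 1) atTop (𝓝 0) := by
    have := hn'.mul hz
    rw [zero_mul] at this
    refine this.congr' ?_
    filter_upwards [hn.eventually_ne_atTop 0] with k hk
    have : (n k : ℂ) ≠ 0 := by exact_mod_cast hk
    field_simp
  have hz1 : Tendsto z atTop (𝓝 1) := by simpa using hz0.add_const 1
  have hlog : (fun k ↦ Complex.log (z k) - (z k - 1)) =o[atTop] fun k ↦ z k - 1 := by
    have := (Complex.hasDerivAt_log Complex.one_mem_slitPlane).isLittleO.comp_tendsto hz1
    simpa [Function.comp_def] using this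
  have h1 : Tendsto (fun k ↦ (n k : ℂ) * (Complex.log (z k) - (z k - 1))) atTop (𝓝 0) :=
    (Asymptotics.isLittleO_one_iff ℂ).1
      (((Asymptotics.isBigO_refl (fun k ↦ (n k : ℂ)) atTop).mul_isLittleO hlog).trans_isBigO
        (hz.isBigO_one ℂ))
  have h2 : Tendsto (fun k ↦ (n k : ℂ) * Complex.log (z k)) atTop (𝓝 c) := by
    have := h1.add hz
    rw [zero_add] at this
    exact this.congr fun k ↦ by ring
  refine ((Complex.continuous_exp.tendsto c).comp h2).congr' ?_
  filter_upwards [hz1.eventually_ne one_ne_zero] with k hk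
  rw [Function.comp_apply, Complex.exp_nat_mul, Complex.exp_log hk]

variable {Ω : Type*} [MeasurableSpace Ω] {P : Measure Ω} [IsProbabilityMeasure P]
  {X : ℝ≥0 → Ω → ℝ}

lemma IsLevyProcess.charFun_map_zero (hX : IsLevyProcess X P) (u : ℝ) :
    charFun (P.map (X 0)) u = 1 := by
  rw [Measure.map_congr (g := fun _ ↦ (0 : ℝ)) hX.zero]
  simp

lemma IsLevyProcess.charFun_map_add (hX : IsLevyProcess X P) (s t : ℝ≥0) (u : ℝ) :
    charFun (P.map (X (s + t))) u = charFun (P.map (X s)) u * charFun (P.map (X t)) u := by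
  have hi : IndepFun (X s) (X (s + t) - X s) P :=
    hX.indepIncrements.indepFun_eval_sub (zero_le (a := s)) (le_self_add) hX.zero
  have h := hi.charFun_map_add_eq_mul (hX.measurable s).aemeasurable
    ((hX.measurable _).sub (hX.measurable s)).aemeasurable
  rw [add_sub_cancel] at h
  rw [h, Pi.mul_apply, ← (hX.stationaryIncrements s t).map_eq]
  rfl

lemma IsLevyProcess.charFun_map_natCast (hX : IsLevyProcess X P) (n : ℕ) (u : ℝ) :
    charFun (P.map (X n)) u = charFun (P.map (X 1)) u ^ n := by
  induction n with
  | zero => simpa using hX.charFun_map_zero u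
  | succ n ih => rw [Nat.cast_succ, hX.charFun_map_add, ih, pow_succ]

/-- Tightness of the values of a Lévy process at times in `[0, 1]`, in terms of characteristic
functions. It holds because the paths are bounded on `[0, 1]`. -/
lemma IsLevyProcess.tendsto_charFun_map_of_le_one (hX : IsLevyProcess X P) {r : ℕ → ℝ≥0}
    (hr : ∀ k, r k ≤ 1) {u : ℕ → ℝ} (hu : Tendsto u atTop (𝓝 0)) :
    Tendsto (fun k ↦ charFun (P.map (X (r k))) (u k)) atTop (𝓝 1) := by
  have h (k : ℕ) : charFun (P.map (X (r k))) (u k) =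
      ∫ ω, Complex.exp (u k * X (r k) ω * Complex.I) ∂P := by
    rw [charFun_apply_real, integral_map (hX.measurable _).aemeasurable (by fun_prop)]
  simp_rw [h]
  have h1 : (1 : ℂ) = ∫ _, (1 : ℂ) ∂P := by simp
  rw [h1]
  refine tendsto_integral_of_dominated_convergence (fun _ ↦ 1) (fun k ↦ ?_) (by simp)
    (fun k ↦ ?_) ?_
  · have := hX.measurable (r k)
    fun_prop
  · refine Eventually.of_forall fun ω ↦ ?_
    rw [← Complex.ofReal_mul, Complex.norm_exp_ofReal_mul_I]
  · filter_upwards [hX.cadlag] with ω hω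
    obtain ⟨C, hC⟩ := hω.exists_abs_le 1
    have h0 : Tendsto (fun k ↦ u k * X (r k) ω) atTop (𝓝 0) :=
      hu.zero_mul_isBoundedUnder_le (isBoundedUnder_of ⟨C, fun k ↦ hC _ (hr k)⟩)
    have h2 : Tendsto (fun k ↦ Complex.exp (((u k * X (r k) ω : ℝ) : ℂ) * Complex.I)) atTop
        (𝓝 (Complex.exp (((0 : ℝ) : ℂ) * Complex.I))) := by
      refine Tendsto.comp (y := 𝓝 (0 : ℝ)) (g := fun x : ℝ ↦ Complex.exp (x * Complex.I)) ?_ h0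
      exact Continuous.tendsto (by fun_prop) 0
    simpa using h2

/-- A Lévy process at large time: the whole part of the time gives a power of the characteristic
function at time `1`, and the fractional part is negligible. -/
lemma IsLevyProcess.tendsto_charFun_map_exp (hX : IsLevyProcess X P) {r : ℕ → ℝ≥0}
    (hr : Tendsto r atTop atTop) {u : ℕ → ℝ} (hu : Tendsto u atTop (𝓝 0)) {c : ℂ}
    (hc : Tendsto (fun k ↦ ((r k : ℝ) : ℂ) * (charFun (P.map (X 1)) (u k) - 1)) atTop (𝓝 c)) :
    Tendsto (fun k ↦ charFun (P.map (X (r k))) (u k)) atTop (𝓝 (Complex.exp c)) := by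
  have := Measure.isProbabilityMeasure_map (μ := P) (hX.measurable 1).aemeasurable
  have hfl (k : ℕ) : (⌊r k⌋₊ : ℝ≥0) ≤ r k := Nat.floor_le zero_le
  have hfr (k : ℕ) : r k - ⌊r k⌋₊ ≤ 1 := by
    rw [tsub_le_iff_left]; exact (Nat.lt_floor_add_one _).le
  have h1 : Tendsto (fun k ↦ charFun (P.map (X 1)) (u k) - 1) atTop (𝓝 0) := by
    have := (continuous_charFun (μ := P.map (X 1))).tendsto 0 |>.comp hu
    simpa [Function.comp_def] using this.sub_const 1
  have hsplit (k : ℕ) : charFun (P.map (X (r k))) (u k) =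
      charFun (P.map (X 1)) (u k) ^ ⌊r k⌋₊ * charFun (P.map (X (r k - ⌊r k⌋₊))) (u k) := by
    rw [← hX.charFun_map_natCast, ← hX.charFun_map_add, add_tsub_cancel_of_le (hfl k)]
  simp_rw [hsplit]
  rw [← mul_one (Complex.exp c)]
  refine Tendsto.mul ?_ (hX.tendsto_charFun_map_of_le_one hfr hu)
  refine tendsto_pow_exp_of_tendsto_mul_sub_one (tendsto_nat_floor_atTop.comp hr) ?_
  -- replacing `r k` by its integer part changes the product by at most `|φ_1 (u k) - 1|`
  have h2 : Tendsto (fun k ↦ (((r k - ⌊r k⌋₊ : ℝ≥0) : ℝ) : ℂ) *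
      (charFun (P.map (X 1)) (u k) - 1)) atTop (𝓝 0) := by
    refine squeeze_zero_norm (fun k ↦ ?_) (tendsto_zero_iff_norm_tendsto_zero.1 h1)
    rw [norm_mul, Complex.norm_real]
    refine mul_le_of_le_one_left (norm_nonneg _) ?_
    simpa using hfr k
  have := hc.sub h2
  rw [sub_zero] at this
  refine this.congr fun k ↦ ?_
  rw [NNReal.coe_sub (hfl k)]
  push_cast
  ring

lemma charFun_sub_one_isLittleO {Y : Ω → ℝ} (hY : MemLp Y 2 P) :
    (fun u ↦ charFun (P.map Y) u - (1 + (P[Y] : ℝ) * u * Complex.I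
      - (P[Y ^ 2] : ℝ) * u ^ 2 / 2)) =o[𝓝 0] fun u ↦ ((u ^ 2 : ℝ) : ℂ) := by
  have hm : AEMeasurable Y P := hY.1.aemeasurable
  have hp := Measure.isProbabilityMeasure_map (μ := P) hm
  have hY' : MemLp id 2 (P.map Y) := (memLp_map_measure_iff (by fun_prop) hm).2 hY
  rw [Complex.isLittleO_ofReal_right]
  simp_rw [← taylorWithinEval_charFun_two_zero hm hY']
  convert! taylor_isLittleO_univ (n := 2) (x₀ := (0 : ℝ)) (contDiff_charFun hY')
  simp

/-- Law of large numbers scaling: `u k` is of order `1 / r k`. -/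
lemma tendsto_mul_charFun_sub_one_of_tendsto_mul {Y : Ω → ℝ} (hY : MemLp Y 2 P) {r u : ℕ → ℝ}
    {a : ℝ} (hu : Tendsto u atTop (𝓝 0)) (ha : Tendsto (fun k ↦ r k * u k) atTop (𝓝 a)) :
    Tendsto (fun k ↦ (r k : ℂ) * (charFun (P.map Y) (u k) - 1)) atTop
      (𝓝 ((P[Y] * a : ℝ) * Complex.I)) := by
  have hu' : Tendsto (fun k ↦ (u k : ℂ)) atTop (𝓝 0) := by
    simpa [Function.comp_def] using (Complex.continuous_ofReal.tendsto 0).comp hu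
  have ha' : Tendsto (fun k ↦ (r k * u k : ℂ)) atTop (𝓝 a) := by
    simpa [Function.comp_def] using (Complex.continuous_ofReal.tendsto a).comp ha
  have h1 := ((Asymptotics.isBigO_refl (fun k ↦ (r k : ℂ)) atTop).mul_isLittleO
    ((charFun_sub_one_isLittleO hY).comp_tendsto hu))
  have h2 : Tendsto (fun k ↦ (r k : ℂ) * ((u k ^ 2 : ℝ) : ℂ)) atTop (𝓝 0) := by
    have := ha'.mul hu'
    rw [mul_zero] at this
    exact this.congr fun k ↦ by push_cast; ring
  have h3 := (Asymptotics.isLittleO_one_iff ℂ).1 (h1.trans_isBigO (h2.isBigO_one ℂ))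
  have h4 := (h3.add (ha'.mul_const ((P[Y] : ℝ) * Complex.I : ℂ))).sub
    (h2.mul_const ((P[Y ^ 2] : ℝ) / 2 : ℂ))
  simp only [zero_add, zero_mul, sub_zero] at h4
  convert! h4 using 2
  · simp only [Function.comp_apply]
    push_cast
    ring
  · push_cast
    ring

/-- Central limit scaling: `u k` is of order `1 / √(r k)`, and the variable is centred. -/
lemma tendsto_mul_charFun_sub_one_of_tendsto_mul_sq {Y : Ω → ℝ} (hY : MemLp Y 2 P)
    (hY0 : P[Y] = 0) {r u : ℕ → ℝ} {a : ℝ} (hu : Tendsto u atTop (𝓝 0))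
    (ha : Tendsto (fun k ↦ r k * u k ^ 2) atTop (𝓝 a)) :
    Tendsto (fun k ↦ (r k : ℂ) * (charFun (P.map Y) (u k) - 1)) atTop
      (𝓝 ((-(P[Y ^ 2] * a / 2) : ℝ) : ℂ)) := by
  have h1 := ((Asymptotics.isBigO_refl (fun k ↦ (r k : ℂ)) atTop).mul_isLittleO
    ((charFun_sub_one_isLittleO hY).comp_tendsto hu))
  have h2 : Tendsto (fun k ↦ (r k : ℂ) * ((u k ^ 2 : ℝ) : ℂ)) atTop (𝓝 a) := by
    simpa [Function.comp_def] using (Complex.continuous_ofReal.tendsto a).comp ha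
  have h3 := (Asymptotics.isLittleO_one_iff ℂ).1 (h1.trans_isBigO (h2.isBigO_one ℂ))
  have h4 := h3.sub (h2.mul_const ((P[Y ^ 2] : ℝ) / 2 : ℂ))
  convert! h4 using 2
  · simp only [Function.comp_apply, hY0]
    push_cast
    ring
  · push_cast
    ring

end

/-! ### A Lévy process at an independent random time -/

section

/-- The first point of the grid of mesh `1 / (n + 1)` that is strictly to the right of `s`. -/
noncomputable def gridAbove (n : ℕ) (s : ℝ≥0) : ℝ≥0 := (⌊(n + 1) * s⌋₊ + 1) / (n + 1)

lemma le_gridAbove (n : ℕ) (s : ℝ≥0) : s ≤ gridAbove n s := by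
  rw [gridAbove, le_div_iff₀ (by positivity), mul_comm]
  exact (Nat.lt_floor_add_one _).le

lemma gridAbove_le (n : ℕ) (s : ℝ≥0) : gridAbove n s ≤ s + 1 / (n + 1) := by
  rw [gridAbove, add_div]
  gcongr
  rw [div_le_iff₀ (by positivity), mul_comm]
  exact Nat.floor_le zero_le

lemma tendsto_gridAbove (s : ℝ≥0) : Tendsto (fun n ↦ gridAbove n s) atTop (𝓝[≥] s) := by
  refine tendsto_nhdsWithin_iff.2 ⟨?_, Eventually.of_forall fun n ↦ le_gridAbove n s⟩
  refine tendsto_of_tendsto_of_tendsto_of_le_of_le tendsto_const_nhds ?_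
    (fun n ↦ le_gridAbove n s) (fun n ↦ gridAbove_le n s)
  have : Tendsto (fun n : ℕ ↦ 1 / ((n : ℝ≥0) + 1)) atTop (𝓝 0) :=
    tendsto_one_div_add_atTop_nhds_zero_nat
  simpa using this.const_add s

/-- Since a grid is countable, evaluating a function at a grid point is jointly measurable in the
function and the point. -/
lemma measurable_eval_gridAbove {α : Type*} [MeasurableSpace α] {f : α → ℝ≥0 → ℝ}
    (hf : ∀ t, Measurable fun a ↦ f a t) (n : ℕ) :
    Measurable fun p : α × ℝ≥0 ↦ f p.1 (gridAbove n p.2) := by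
  have h1 : Measurable fun p : α × ℕ ↦ f p.1 ((p.2 + 1) / (n + 1)) :=
    measurable_from_prod_countable_left fun k : ℕ ↦ hf ((k + 1) / (n + 1))
  have h2 : Measurable fun p : α × ℝ≥0 ↦ (p.1, ⌊(n + 1) * p.2⌋₊) :=
    measurable_fst.prodMk (Nat.measurable_floor.comp (measurable_snd.const_mul _))
  exact h1.comp h2

variable {Ω : Type*} [MeasurableSpace Ω] {P : Measure Ω}
  {X : ℝ≥0 → Ω → ℝ} {T : Ω → ℝ≥0}

lemma IsLevyProcess.ae_tendsto_gridAbove (hX : IsLevyProcess X P) (T : Ω → ℝ≥0) :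
    ∀ᵐ ω ∂P, Tendsto (fun n ↦ X (gridAbove n (T ω)) ω) atTop (𝓝 (X (T ω) ω)) := by
  filter_upwards [hX.cadlag] with ω hω
  exact (hω (T ω)).1.tendsto.comp (tendsto_gridAbove _)

lemma IsLevyProcess.aemeasurable_eval_gridAbove (hX : IsLevyProcess X P) (hT : AEMeasurable T P)
    (n : ℕ) : AEMeasurable (fun ω ↦ X (gridAbove n (T ω)) ω) P := by
  have h1 : Measurable fun p : Ω × ℝ≥0 ↦ X (gridAbove n p.2) p.1 :=
    measurable_eval_gridAbove (f := fun ω t ↦ X t ω) hX.measurable n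
  have h2 : AEMeasurable (fun ω ↦ (ω, T ω)) P := AEMeasurable.prodMk aemeasurable_id' hT
  simpa only [Function.comp_def] using h1.comp_aemeasurable h2

/-- A right-continuous process evaluated at a random time is a limit of its evaluations at grid
points. -/
lemma IsLevyProcess.aemeasurable_eval (hX : IsLevyProcess X P) (hT : AEMeasurable T P) :
    AEMeasurable (fun ω ↦ X (T ω) ω) P := by
  exact aemeasurable_of_tendsto_metrizable_ae atTop (hX.aemeasurable_eval_gridAbove hT)
    (hX.ae_tendsto_gridAbove T)

lemma tendsto_charFun_map_of_ae_tendsto [IsProbabilityMeasure P] {Y : ℕ → Ω → ℝ} {Z : Ω → ℝ}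
    (hY : ∀ n, AEMeasurable (Y n) P) (h : ∀ᵐ ω ∂P, Tendsto (fun n ↦ Y n ω) atTop (𝓝 (Z ω)))
    (u : ℝ) :
    Tendsto (fun n ↦ charFun (P.map (Y n)) u) atTop (𝓝 (charFun (P.map Z) u)) := by
  have hZ : AEMeasurable Z P := aemeasurable_of_tendsto_metrizable_ae atTop hY h
  simp_rw [charFun_apply_real]
  rw [integral_map hZ (by fun_prop)]
  simp_rw [fun n ↦ integral_map (hY n) (f := fun x : ℝ ↦ Complex.exp (u * x * Complex.I))
    (by fun_prop)]
  refine tendsto_integral_of_dominated_convergence (fun _ ↦ 1) (fun n ↦ ?_) (by simp)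
    (fun n ↦ Eventually.of_forall fun ω ↦ ?_) ?_
  · have := hY n
    fun_prop
  · rw [← Complex.ofReal_mul, Complex.norm_exp_ofReal_mul_I]
  · filter_upwards [h] with ω hω
    exact (Continuous.tendsto (f := fun x : ℝ ↦ Complex.exp (u * x * Complex.I)) (by fun_prop)
      (Z ω)).comp hω

lemma IsLevyProcess.tendsto_charFun_map_gridAbove [IsProbabilityMeasure P]
    (hX : IsLevyProcess X P) (u : ℝ) (s : ℝ≥0) :
    Tendsto (fun n ↦ charFun (P.map (X (gridAbove n s))) u) atTop
      (𝓝 (charFun (P.map (X s)) u)) :=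
  tendsto_charFun_map_of_ae_tendsto (fun _ ↦ (hX.measurable _).aemeasurable)
    (hX.ae_tendsto_gridAbove fun _ ↦ s) u

lemma measurable_gridAbove_comp {β : Type*} [MeasurableSpace β] (f : ℝ≥0 → β) (n : ℕ) :
    Measurable fun s ↦ f (gridAbove n s) :=
  (measurable_from_nat (f := fun k : ℕ ↦ f ((k + 1) / (n + 1)))).comp
    (Nat.measurable_floor.comp (measurable_id.const_mul _))

lemma IsLevyProcess.measurable_charFun_map [IsProbabilityMeasure P]
    (hX : IsLevyProcess X P) (u : ℝ) :
    Measurable fun s ↦ charFun (P.map (X s)) u :=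
  measurable_of_tendsto_metrizable
    (fun n ↦ measurable_gridAbove_comp (fun s ↦ charFun (P.map (X s)) u) n)
    (tendsto_pi_nhds.2 fun s ↦ hX.tendsto_charFun_map_gridAbove u s)

lemma norm_charFun_map_le_one [IsProbabilityMeasure P] (Y : Ω → ℝ) (u : ℝ) :
    ‖charFun (P.map Y) u‖ ≤ 1 := by
  have h := norm_charFun_le (μ := P.map Y) u
  refine h.trans ?_
  by_cases hY : AEMeasurable Y P
  · have := Measure.isProbabilityMeasure_map hY
    simp
  · simp [Measure.map_of_not_aemeasurable hY]

/-- The characteristic function of a Lévy process at an independent random time is the mixture of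
the characteristic functions at the deterministic times. The identity is Fubini's theorem on path
space for the times rounded up to a grid (on the path space itself evaluation at an arbitrary time
is not jointly measurable), and right-continuity gives the general case. -/
lemma IsLevyProcess.charFun_map_eval [IsProbabilityMeasure P]
    (hX : IsLevyProcess X P) (hT : AEMeasurable T P)
    (hXT : IndepFun (fun ω (t : ℝ≥0) ↦ X t ω) T P) (u : ℝ) :
    charFun (P.map fun ω ↦ X (T ω) ω) u = ∫ s, charFun (P.map (X s)) u ∂(P.map T) := by
  have := Measure.isProbabilityMeasure_map hT
  have hpath : Measurable fun ω (t : ℝ≥0) ↦ X t ω := measurable_pi_lambda _ hX.measurable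
  have := Measure.isProbabilityMeasure_map (μ := P) hpath.aemeasurable
  have hgrid (n : ℕ) : charFun (P.map fun ω ↦ X (gridAbove n (T ω)) ω) u =
      ∫ s, charFun (P.map (X (gridAbove n s))) u ∂(P.map T) := by
    have hm : Measurable fun p : (ℝ≥0 → ℝ) × ℝ≥0 ↦
        Complex.exp (u * p.1 (gridAbove n p.2) * Complex.I) := by
      have := measurable_eval_gridAbove (f := fun (x : ℝ≥0 → ℝ) t ↦ x t) measurable_pi_apply n
      fun_prop
    calc charFun (P.map fun ω ↦ X (gridAbove n (T ω)) ω) u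
        = ∫ ω, Complex.exp (u * X (gridAbove n (T ω)) ω * Complex.I) ∂P := by
          rw [charFun_apply_real, integral_map (hX.aemeasurable_eval_gridAbove hT n) (by fun_prop)]
      _ = ∫ p : (ℝ≥0 → ℝ) × ℝ≥0, Complex.exp (u * p.1 (gridAbove n p.2) * Complex.I)
            ∂(P.map fun ω ↦ (fun t ↦ X t ω, T ω)) := by
          rw [integral_map (hpath.aemeasurable.prodMk hT) hm.aestronglyMeasurable]
      _ = ∫ s, ∫ x : ℝ≥0 → ℝ, Complex.exp (u * x (gridAbove n s) * Complex.I)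
            ∂(P.map fun ω t ↦ X t ω) ∂(P.map T) := by
          rw [(indepFun_iff_map_prod_eq_prod_map_map hpath.aemeasurable hT).1 hXT,
            integral_prod_symm _ (Integrable.of_bound hm.aestronglyMeasurable 1
              (Eventually.of_forall fun p ↦ ?_))]
          rw [← Complex.ofReal_mul, Complex.norm_exp_ofReal_mul_I]
      _ = ∫ s, charFun (P.map (X (gridAbove n s))) u ∂(P.map T) := by
          congr with s
          rw [charFun_apply_real, integral_map (hX.measurable _).aemeasurable (by fun_prop),
            integral_map hpath.aemeasurable
              (Measurable.aestronglyMeasurable (by fun_prop))]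
  have h1 := tendsto_charFun_map_of_ae_tendsto (hX.aemeasurable_eval_gridAbove hT)
    (hX.ae_tendsto_gridAbove T) u
  refine tendsto_nhds_unique h1 ?_
  refine Tendsto.congr (fun n ↦ (hgrid n).symm) ?_
  refine tendsto_integral_of_dominated_convergence (fun _ ↦ 1) (fun n ↦ ?_) (by simp)
    (fun n ↦ Eventually.of_forall fun s ↦ norm_charFun_map_le_one _ _)
    (Eventually.of_forall fun s ↦ hX.tendsto_charFun_map_gridAbove u s)
  exact (measurable_gridAbove_comp (fun s ↦ charFun (P.map (X s)) u) n).aestronglyMeasurable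

end

/-! ### The stable subordinator and its inverse -/

section

variable {Ω Ω' : Type*} [MeasurableSpace Ω] [MeasurableSpace Ω'] {μ : Measure Ω} {μ' : Measure Ω'}

/-- The moments of `exp (-X)` are the values of the Laplace transform of `X` at the natural
numbers. -/
lemma tsum_mgf_neg_natCast_eq_complexMGF_exp_neg [IsFiniteMeasure μ] {X : Ω → ℝ}
    (hX : AEMeasurable X μ) (hX0 : ∀ᵐ ω ∂μ, 0 ≤ X ω) (z : ℂ) :
    ∑' n : ℕ, (n.factorial : ℂ)⁻¹ * (mgf X μ (-n) : ℝ) * z ^ n =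
      complexMGF (fun ω ↦ Real.exp (-X ω)) μ z := by
  have hU : AEMeasurable (fun ω ↦ Real.exp (-X ω)) μ := by fun_prop
  have hset : integrableExpSet (fun ω ↦ Real.exp (-X ω)) μ = univ := by
    refine eq_univ_of_forall fun t ↦ integrable_exp_mul_of_mem_Icc (a := 0) (b := 1) hU ?_
    filter_upwards [hX0] with ω hω
    exact ⟨(Real.exp_pos _).le, by simpa using hω⟩
  have hdiff : Differentiable ℂ (complexMGF (fun ω ↦ Real.exp (-X ω)) μ) := fun z ↦
    (hasDerivAt_complexMGF (by simp [hset])).differentiableAt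
  rw [← Complex.taylorSeries_eq_of_entire' 0 z hdiff]
  congr with n
  rw [iteratedDeriv_complexMGF (by simp [hset]), sub_zero]
  congr 2
  rw [mgf, ← integral_complex_ofReal]
  congr with ω
  simp [← Complex.exp_nat_mul]

lemma map_eq_map_neg_log_map_exp_neg {X : Ω → ℝ} (hX : AEMeasurable X μ) :
    μ.map X = (μ.map fun ω ↦ Real.exp (-X ω)).map fun x ↦ -Real.log x := by
  rw [AEMeasurable.map_map_of_aemeasurable (by fun_prop) (by fun_prop)]
  simp [Function.comp_def]

/-- The Laplace transform of a nonnegative variable determines its law, and even its values at the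
natural numbers do: they are the moments of the bounded variable `exp (-X)`, whose complex moment
generating function is entire and so equal to its Taylor series at `0`. -/
lemma map_eq_of_forall_mgf_neg_natCast_eq [IsFiniteMeasure μ] [IsFiniteMeasure μ'] {X : Ω → ℝ}
    {Y : Ω' → ℝ} (hX : AEMeasurable X μ) (hY : AEMeasurable Y μ') (hX0 : ∀ᵐ ω ∂μ, 0 ≤ X ω)
    (hY0 : ∀ᵐ ω ∂μ', 0 ≤ Y ω) (h : ∀ n : ℕ, mgf X μ (-n) = mgf Y μ' (-n)) :
    μ.map X = μ'.map Y := by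
  rw [map_eq_map_neg_log_map_exp_neg hX, map_eq_map_neg_log_map_exp_neg hY]
  congr 1
  refine Measure.ext_of_complexMGF_eq (by fun_prop) (by fun_prop) (funext fun z ↦ ?_)
  simp_rw [← tsum_mgf_neg_natCast_eq_complexMGF_exp_neg hX hX0,
    ← tsum_mgf_neg_natCast_eq_complexMGF_exp_neg hY hY0, h]

lemma measure_Iic_le_of_forall_Iio_le_Iic {μ μ' : Measure ℝ≥0} [IsFiniteMeasure μ']
    (h : ∀ x, μ (Iio x) ≤ μ' (Iic x)) (x : ℝ≥0) : μ (Iic x) ≤ μ' (Iic x) := by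
  have hlim : Tendsto (fun n : ℕ ↦ x + 1 / ((n : ℝ≥0) + 1)) atTop (𝓝 x) := by
    simpa using (tendsto_one_div_add_atTop_nhds_zero_nat (𝕜 := ℝ≥0)).const_add x
  have hI : ⋂ n : ℕ, Iic (x + 1 / ((n : ℝ≥0) + 1)) = Iic x := by
    ext y
    simp only [mem_iInter, mem_Iic]
    exact ⟨fun hy ↦ ge_of_tendsto' hlim hy, fun hy n ↦ hy.trans le_self_add⟩
  have ht : Tendsto (fun n : ℕ ↦ μ' (Iic (x + 1 / ((n : ℝ≥0) + 1)))) atTop (𝓝 (μ' (Iic x))) := by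
    rw [← hI]
    refine tendsto_measure_iInter_atTop (fun n ↦ measurableSet_Iic.nullMeasurableSet) ?_
      ⟨0, measure_ne_top _ _⟩
    intro m n hmn
    refine Iic_subset_Iic.2 ?_
    gcongr
  refine ge_of_tendsto' ht fun n ↦ le_trans (measure_mono ?_) (h _)
  have hpos : 0 < 1 / ((n : ℝ≥0) + 1) := by positivity
  exact fun y hy ↦ lt_of_le_of_lt hy (lt_add_of_pos_right x hpos)

/-- Two laws on `[0, ∞)` whose distribution functions interlace are equal, because distribution
functions are right-continuous. -/
lemma measure_eq_of_forall_Iio_le_Iic {μ μ' : Measure ℝ≥0} [IsFiniteMeasure μ]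
    [IsFiniteMeasure μ'] (h : ∀ x, μ (Iio x) ≤ μ' (Iic x)) (h' : ∀ x, μ' (Iio x) ≤ μ (Iic x)) :
    μ = μ' := by
  exact Measure.ext_of_Iic _ _ fun x ↦ le_antisymm (measure_Iic_le_of_forall_Iio_le_Iic h x)
    (measure_Iic_le_of_forall_Iio_le_Iic h' x)

variable {P : Measure Ω} {ν : ℝ} {D : ℝ≥0 → Ω → ℝ} {L : ℝ≥0 → Ω → ℝ≥0}

lemma IsSubordinator.ae_nonneg (hD : IsSubordinator D P) (t : ℝ≥0) : ∀ᵐ ω ∂P, 0 ≤ D t ω := by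
  filter_upwards [hD.zero, hD.monotone] with ω h0 hm
  exact h0 ▸ hm (zero_le (a := t))

/-- By Markov's inequality `P (D n ≤ t) ≤ exp (t - n)`. -/
lemma IsStableSubordinator.ae_exists_lt [IsProbabilityMeasure P] (hD : IsStableSubordinator ν D P)
    (t : ℝ) : ∀ᵐ ω ∂P, ∃ s, t < D s ω := by
  have hle (n : ℕ) : P.real {ω | ∀ s, D s ω ≤ t} ≤ Real.exp t * Real.exp (-(n : ℝ)) := by
    have hint : Integrable (fun ω ↦ Real.exp (-1 * D n ω)) P := by
      have := hD.measurable n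
      refine Integrable.of_bound (by fun_prop) 1 ?_
      filter_upwards [hD.ae_nonneg n] with ω hω
      rw [Real.norm_eq_abs, Real.abs_exp]
      simpa using hω
    have h1 := measure_le_le_exp_mul_mgf t (by norm_num : (-1 : ℝ) ≤ 0) hint
    have h2 := hD.laplace n 1
    simp only [NNReal.coe_one, Real.one_rpow, mul_one, NNReal.coe_natCast] at h2
    rw [h2, neg_neg, one_mul] at h1
    exact (measureReal_mono fun ω (hω : ∀ s, D s ω ≤ t) ↦ hω n).trans h1
  have hlim : Tendsto (fun n : ℕ ↦ Real.exp t * Real.exp (-(n : ℝ))) atTop (𝓝 0) := by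
    have := (Real.tendsto_exp_neg_atTop_nhds_zero.comp tendsto_natCast_atTop_atTop).const_mul
      (Real.exp t)
    simpa [Function.comp_def] using this
  have h0 : P.real {ω | ∀ s, D s ω ≤ t} = 0 :=
    le_antisymm (ge_of_tendsto' hlim hle) measureReal_nonneg
  rw [ae_iff]
  simpa [measureReal_eq_zero_iff] using h0

/-- Self-similarity of the stable subordinator at a single time. -/
lemma IsStableSubordinator.map_inv_mul_eq [IsProbabilityMeasure P]
    (hD : IsStableSubordinator ν D P) {t : ℝ≥0} (ht : 0 < t) (x : ℝ≥0) :
    P.map (fun ω ↦ (t : ℝ)⁻¹ * D (t ^ ν * x) ω) = P.map (D x) := by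
  have h1 := hD.measurable (t ^ ν * x)
  refine map_eq_of_forall_mgf_neg_natCast_eq (by fun_prop) (hD.measurable x).aemeasurable ?_
    (hD.ae_nonneg x) fun n ↦ ?_
  · filter_upwards [hD.ae_nonneg (t ^ ν * x)] with ω hω
    positivity
  · have h2 := hD.laplace (t ^ ν * x) (t⁻¹ * n)
    have h3 := hD.laplace x n
    rw [NNReal.coe_natCast] at h3
    rw [mgf_const_mul, h3, mul_neg]
    convert! h2 using 3
    push_cast
    have ht' : (0 : ℝ) < t := ht
    rw [Real.mul_rpow (by positivity) (by positivity), Real.inv_rpow (by positivity)]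
    have := Real.rpow_pos_of_pos ht' ν
    field_simp

/-- First passage below time `x` means that the level is exceeded strictly before `x`. The level is
almost surely exceeded, so that the infimum is over a nonempty set and takes no junk value. -/
lemma IsStableSubordinator.ae_lt_iff_exists_lt [IsProbabilityMeasure P]
    (hD : IsStableSubordinator ν D P)
    (hL : ∀ᵐ ω ∂P, ∀ t : ℝ≥0, L t ω = sInf {s : ℝ≥0 | (t : ℝ) < D s ω}) (t : ℝ≥0) :
    ∀ᵐ ω ∂P, Monotone (fun s ↦ D s ω) ∧ (∀ x, L t ω < x ↔ ∃ s < x, (t : ℝ) < D s ω) := by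
  filter_upwards [hL, hD.monotone, hD.ae_exists_lt t] with ω h hm hne
  refine ⟨hm, fun x ↦ ?_⟩
  have hne' : {s : ℝ≥0 | (t : ℝ) < D s ω}.Nonempty := hne
  rw [h t, csInf_lt_iff (OrderBot.bddBelow _) hne']
  exact ⟨fun ⟨s, h1, h2⟩ ↦ ⟨s, h2, h1⟩, fun ⟨s, h1, h2⟩ ↦ ⟨s, h2, h1⟩⟩

/-- The event `L t < x` is a countable union of events `t < D s`. -/
lemma IsInverseStableSubordinator.aemeasurable [IsProbabilityMeasure P]
    (hL : IsInverseStableSubordinator ν L P) (t : ℝ≥0) : AEMeasurable (L t) P := by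
  obtain ⟨D, hD, hL⟩ := hL
  have hnull (x : ℝ≥0) : NullMeasurableSet (L t ⁻¹' Iio x) P := by
    let d := TopologicalSpace.denseSeq ℝ≥0
    have hms : MeasurableSet (⋃ n, ⋃ (_ : d n < x), {ω | (t : ℝ) < D (d n) ω}) :=
      .iUnion fun n ↦ .iUnion fun _ ↦ measurableSet_lt measurable_const (hD.measurable _)
    refine NullMeasurableSet.congr hms.nullMeasurableSet (eventuallyEq_set.2 ?_)
    filter_upwards [hD.ae_lt_iff_exists_lt hL t] with ω ⟨hm, h⟩
    simp only [mem_iUnion, exists_prop, mem_ofPred_eq, mem_preimage, mem_Iio, h]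
    constructor
    · rintro ⟨n, hn, hn'⟩
      exact ⟨d n, hn, hn'⟩
    · rintro ⟨s, hsx, hs⟩
      obtain ⟨_, ⟨n, rfl⟩, h1, h2⟩ :=
        (TopologicalSpace.denseRange_denseSeq ℝ≥0).exists_between hsx
      exact ⟨n, h2, hs.trans_le (hm h1.le)⟩
  have h : @Measurable (NullMeasurableSpace Ω P) ℝ≥0 _ _ (L t) := measurable_of_Iio hnull
  exact NullMeasurable.aemeasurable fun s hs ↦ h hs

/-- Self-similarity of the inverse stable subordinator at a single time: up to the boundary of the
event, `L t < t ^ ν * x` means `t < D (t ^ ν * x)`. -/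
lemma IsInverseStableSubordinator.map_eq_map_mul [IsProbabilityMeasure P]
    (hL : IsInverseStableSubordinator ν L P) {t : ℝ≥0} (ht : 0 < t) :
    P.map (L t) = P.map fun ω ↦ t ^ ν * L 1 ω := by
  have hmt := hL.aemeasurable t
  have hm1 := hL.aemeasurable 1
  obtain ⟨D, hD, hL⟩ := hL
  have htν : 0 < t ^ ν := NNReal.rpow_pos ht
  have hlo (t x : ℝ≥0) : P {ω | L t ω < x} ≤ P {ω | (t : ℝ) < D x ω} := by
    refine measure_mono_ae ?_
    filter_upwards [hD.ae_lt_iff_exists_lt hL t] with ω ⟨hm, h⟩ hω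
    obtain ⟨s, hs, hs'⟩ := (h x).1 hω
    exact hs'.trans_le (hm hs.le)
  have hhi (t x : ℝ≥0) : P {ω | (t : ℝ) < D x ω} ≤ P {ω | L t ω ≤ x} := by
    refine measure_mono_ae ?_
    filter_upwards [hD.ae_lt_iff_exists_lt hL t] with ω ⟨hm, h⟩ hω
    exact le_of_forall_gt fun y hy ↦ (h y).2 ⟨x, hy, hω⟩
  have hsc (x : ℝ≥0) : P {ω | (t : ℝ) < D (t ^ ν * x) ω} = P {ω | ((1 : ℝ≥0) : ℝ) < D x ω} := by
    have h1 := congrArg (fun μ ↦ μ (Ioi 1)) (hD.map_inv_mul_eq ht x)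
    have h2 := hD.measurable (t ^ ν * x)
    rw [Measure.map_apply (by fun_prop) measurableSet_Ioi,
      Measure.map_apply (hD.measurable x) measurableSet_Ioi] at h1
    convert! h1 using 2
    ext ω
    have ht' : (0 : ℝ) < t := ht
    simp [lt_inv_mul_iff₀ ht']
  have hscale (x : ℝ≥0) : x = t ^ ν * (x / t ^ ν) := by field_simp
  have := Measure.isProbabilityMeasure_map hmt
  have := Measure.isProbabilityMeasure_map (μ := P) (f := fun ω ↦ t ^ ν * L 1 ω) (by fun_prop)
  refine measure_eq_of_forall_Iio_le_Iic (fun x ↦ ?_) fun x ↦ ?_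
  · rw [Measure.map_apply_of_aemeasurable hmt measurableSet_Iio,
      Measure.map_apply_of_aemeasurable (by fun_prop) measurableSet_Iic]
    calc P {ω | L t ω < x} ≤ P {ω | (t : ℝ) < D x ω} := hlo t x
      _ = P {ω | ((1 : ℝ≥0) : ℝ) < D (x / t ^ ν) ω} := by rw [← hsc, ← hscale]
      _ ≤ P {ω | L 1 ω ≤ x / t ^ ν} := hhi 1 _
      _ = P ((fun ω ↦ t ^ ν * L 1 ω) ⁻¹' Iic x) := by
        congr with ω
        simp [le_div_iff₀' htν]
  · rw [Measure.map_apply_of_aemeasurable hmt measurableSet_Iic,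
      Measure.map_apply_of_aemeasurable (by fun_prop) measurableSet_Iio]
    calc P ((fun ω ↦ t ^ ν * L 1 ω) ⁻¹' Iio x) = P {ω | L 1 ω < x / t ^ ν} := by
          congr with ω
          simp [lt_div_iff₀' htν]
      _ ≤ P {ω | ((1 : ℝ≥0) : ℝ) < D (x / t ^ ν) ω} := hlo 1 _
      _ = P {ω | (t : ℝ) < D x ω} := by rw [← hsc, ← hscale]
      _ ≤ P {ω | L t ω ≤ x} := hhi t x

end

/-! ### The time-changed process -/

section

variable {Ω : Type*} [MeasurableSpace Ω] {P : Measure Ω} [IsProbabilityMeasure P]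
  {X : ℝ≥0 → Ω → ℝ} {ν : ℝ} {L : ℝ≥0 → Ω → ℝ≥0}

lemma NNReal.tendsto_rpow_mul_atTop {t : ℕ → ℝ≥0} (ht : Tendsto t atTop atTop) (hν : 0 < ν)
    {s : ℝ≥0} (hs : 0 < s) : Tendsto (fun k ↦ t k ^ ν * s) atTop atTop :=
  ((NNReal.tendsto_rpow_atTop hν).comp ht).atTop_mul_const hs

lemma tendsto_mul_coe_rpow_neg {t : ℕ → ℝ≥0} (ht : Tendsto t atTop atTop) {β : ℝ} (hβ : 0 < β)
    (u : ℝ) : Tendsto (fun k ↦ u * (t k : ℝ) ^ (-β)) atTop (𝓝 0) := by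
  have := ((tendsto_rpow_neg_atTop hβ).comp (NNReal.tendsto_coe_atTop.2 ht)).const_mul u
  simpa [Function.comp_def] using this

/-- The central limit theorem for a centred Lévy process, at the time `t ^ ν * s`. -/
lemma IsLevyProcess.tendsto_charFun_map_of_integral_eq_zero (hX : IsLevyProcess X P)
    (hX2 : MemLp (X 1) 2 P) (h0 : P[X 1] = 0) (hν : 0 < ν) {t : ℕ → ℝ≥0}
    (ht : Tendsto t atTop atTop) (u : ℝ) (s : ℝ≥0) :
    Tendsto (fun k ↦ charFun (P.map (X (t k ^ ν * s))) (u * (t k : ℝ) ^ (-(ν / 2)))) atTop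
      (𝓝 (Complex.exp ((-(P[X 1 ^ 2] * (s * u ^ 2) / 2) : ℝ) : ℂ))) := by
  obtain rfl | hs := eq_or_ne s 0
  · simp [hX.charFun_map_zero]
  have hu := tendsto_mul_coe_rpow_neg ht (half_pos hν) u
  refine hX.tendsto_charFun_map_exp (NNReal.tendsto_rpow_mul_atTop ht hν hs.bot_lt) hu ?_
  refine tendsto_mul_charFun_sub_one_of_tendsto_mul_sq hX2 h0 hu ?_
  refine Tendsto.congr' ?_ tendsto_const_nhds
  filter_upwards [ht.eventually_gt_atTop 0] with k hk
  have hk' : (0 : ℝ) < t k := hk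
  rw [mul_pow, ← Real.rpow_natCast ((t k : ℝ) ^ (-(ν / 2))), ← Real.rpow_mul hk'.le,
    show -(ν / 2) * (2 : ℕ) = -ν by push_cast; ring, Real.rpow_neg hk'.le]
  have := Real.rpow_pos_of_pos hk' ν
  push_cast
  field_simp

/-- The weak law of large numbers for a square integrable Lévy process, at the time `t ^ ν * s`. -/
lemma IsLevyProcess.tendsto_charFun_map_of_memLp_two (hX : IsLevyProcess X P)
    (hX2 : MemLp (X 1) 2 P) (hν : 0 < ν) {t : ℕ → ℝ≥0}
    (ht : Tendsto t atTop atTop) (u : ℝ) (s : ℝ≥0) :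
    Tendsto (fun k ↦ charFun (P.map (X (t k ^ ν * s))) (u * (t k : ℝ) ^ (-ν))) atTop
      (𝓝 (Complex.exp ((P[X 1] * (s * u) : ℝ) * Complex.I))) := by
  obtain rfl | hs := eq_or_ne s 0
  · simp [hX.charFun_map_zero]
  have hu := tendsto_mul_coe_rpow_neg ht hν u
  refine hX.tendsto_charFun_map_exp (NNReal.tendsto_rpow_mul_atTop ht hν hs.bot_lt) hu ?_
  refine tendsto_mul_charFun_sub_one_of_tendsto_mul hX2 hu ?_
  refine Tendsto.congr' ?_ tendsto_const_nhds
  filter_upwards [ht.eventually_gt_atTop 0] with k hk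
  have hk' : (0 : ℝ) < t k := hk
  rw [Real.rpow_neg hk'.le]
  have := Real.rpow_pos_of_pos hk' ν
  push_cast
  field_simp

/-- If the Lévy process at the deterministic times `t ^ ν * s`, scaled by `t ^ (-β)`, converges in
distribution for every `s`, then so does its composition with an independent inverse stable
subordinator, and the limit is the mixture of the limits over the law of `L 1`. -/
lemma tendstoInDistribution_eval_inverseStableSubordinator {Ω' : Type*} [MeasurableSpace Ω']
    {P' : Measure Ω'} [IsProbabilityMeasure P'] {W : Ω' → ℝ} (hX : IsLevyProcess X P)
    (hL : IsInverseStableSubordinator ν L P)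
    (hXL : IndepFun (fun ω (t : ℝ≥0) ↦ X t ω) (fun ω (t : ℝ≥0) ↦ L t ω) P)
    (hW : AEMeasurable W P') {α β : ℝ} (hαβ : α - 1 = -β) {g : ℝ → ℝ≥0 → ℂ}
    (hg : ∀ (t : ℕ → ℝ≥0), Tendsto t atTop atTop → ∀ u s,
      Tendsto (fun k ↦ charFun (P.map (X (t k ^ ν * s))) (u * (t k : ℝ) ^ (-β))) atTop (𝓝 (g u s)))
    (hgW : ∀ u, charFun (P'.map W) u = ∫ s, g u s ∂(P.map (L 1))) :
    TendstoInDistribution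
      (fun (t : ℝ≥0) ω ↦ (t : ℝ) ^ α * (X (L t ω) ω / (t : ℝ))) atTop W (fun _ ↦ P) P' := by
  have hm (t : ℝ≥0) : AEMeasurable (fun ω ↦ X (L t ω) ω) P :=
    hX.aemeasurable_eval (hL.aemeasurable t)
  have hm1 := hL.aemeasurable 1
  have := Measure.isProbabilityMeasure_map hm1
  refine ⟨fun t ↦ ((hm t).div_const _).const_mul _, hW, ?_⟩
  refine tendsto_iff_seq_tendsto.2 fun t ht ↦ ?_
  refine ProbabilityMeasure.tendsto_iff_tendsto_charFun.2 fun u ↦ ?_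
  change Tendsto (fun k ↦ charFun (P.map fun ω ↦ (t k : ℝ) ^ α * (X (L (t k) ω) ω / (t k : ℝ))) u)
    atTop (𝓝 (charFun (P'.map W) u))
  rw [hgW]
  have hcf : ∀ᶠ k in atTop, ∫ s, charFun (P.map (X (t k ^ ν * s))) (u * (t k : ℝ) ^ (-β))
      ∂(P.map (L 1)) =
      charFun (P.map fun ω ↦ (t k : ℝ) ^ α * (X (L (t k) ω) ω / (t k : ℝ))) u := by
    filter_upwards [ht.eventually_gt_atTop 0] with k hk
    have hk' : (0 : ℝ) < t k := hk
    have hind : IndepFun (fun ω (t : ℝ≥0) ↦ X t ω) (L (t k)) P :=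
      hXL.comp measurable_id (measurable_pi_apply (t k))
    have hscale : (fun ω ↦ (t k : ℝ) ^ α * (X (L (t k) ω) ω / (t k : ℝ))) =
        fun ω ↦ (t k : ℝ) ^ (-β) * X (L (t k) ω) ω := by
      ext ω
      rw [← hαβ, Real.rpow_sub_one hk'.ne']
      ring
    have hmap : P.map (L (t k)) = (P.map (L 1)).map fun s ↦ t k ^ ν * s := by
      rw [hL.map_eq_map_mul hk, AEMeasurable.map_map_of_aemeasurable (by fun_prop) hm1]
      rfl
    rw [hscale, charFun_map_mul_comp (hm _), mul_comm _ u,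
      hX.charFun_map_eval (hL.aemeasurable _) hind, hmap,
      integral_map (by fun_prop) (hX.measurable_charFun_map _).aestronglyMeasurable]
  refine Tendsto.congr' hcf ?_
  refine tendsto_integral_of_dominated_convergence (fun _ ↦ 1) (fun k ↦ ?_) (by simp)
    (fun k ↦ Eventually.of_forall fun s ↦ norm_charFun_map_le_one _ _)
    (Eventually.of_forall fun s ↦ hg t ht u s)
  exact ((hX.measurable_charFun_map _).comp (measurable_const_mul (t k ^ ν))).aestronglyMeasurable

/-- Conditionally on `Y`, the variable `√(q * Y) * Z` is a centred Gaussian of variance `q * Y`. -/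
lemma charFun_map_sqrt_mul_mul_gaussian {Y : Ω → ℝ≥0} {Z : Ω → ℝ} (hY : AEMeasurable Y P)
    (hZ : HasLaw Z (gaussianReal 0 1) P) (hYZ : IndepFun Y Z P) {q : ℝ} (hq : 0 ≤ q) (u : ℝ) :
    charFun (P.map fun ω ↦ √(q * (Y ω : ℝ)) * Z ω) u =
      ∫ s, Complex.exp ((-(q * (s * u ^ 2) / 2) : ℝ) : ℂ) ∂(P.map Y) := by
  have hZm := hZ.aemeasurable
  have := Measure.isProbabilityMeasure_map hY
  have hm : Measurable fun p : ℝ≥0 × ℝ ↦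
      Complex.exp (u * (√(q * (p.1 : ℝ)) * p.2 : ℝ) * Complex.I) := by
    fun_prop
  calc charFun (P.map fun ω ↦ √(q * (Y ω : ℝ)) * Z ω) u
      = ∫ ω, Complex.exp (u * (√(q * (Y ω : ℝ)) * Z ω : ℝ) * Complex.I) ∂P := by
        rw [charFun_apply_real, integral_map (by fun_prop) (by fun_prop)]
    _ = ∫ p : ℝ≥0 × ℝ, Complex.exp (u * (√(q * (p.1 : ℝ)) * p.2 : ℝ) * Complex.I)
          ∂(P.map fun ω ↦ (Y ω, Z ω)) := by
        rw [integral_map (hY.prodMk hZm) hm.aestronglyMeasurable]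
    _ = ∫ s, ∫ z, Complex.exp (u * (√(q * (s : ℝ)) * z : ℝ) * Complex.I)
          ∂(gaussianReal 0 1) ∂(P.map Y) := by
        rw [(indepFun_iff_map_prod_eq_prod_map_map hY hZm).1 hYZ, hZ.map_eq,
          integral_prod _ (Integrable.of_bound hm.aestronglyMeasurable 1
            (Eventually.of_forall fun p ↦ ?_))]
        rw [← Complex.ofReal_mul, Complex.norm_exp_ofReal_mul_I]
    _ = ∫ s, Complex.exp ((-(q * (s * u ^ 2) / 2) : ℝ) : ℂ) ∂(P.map Y) := by
        congr with s
        have h := charFun_gaussianReal (μ := 0) (v := 1) (u * √(q * (s : ℝ)))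
        rw [charFun_apply_real] at h
        have hs : √(q * (s : ℝ)) ^ 2 = q * s := Real.sq_sqrt (by positivity)
        calc _ = _ := by
              congr with z
              push_cast
              ring_nf
          _ = _ := h
          _ = _ := by
              have : -(q * (s * u ^ 2) / 2) = -((u * √(q * (s : ℝ))) ^ 2 / 2) := by
                rw [mul_pow, hs]; ring
              rw [this]
              push_cast
              ring_nf

end

theorem mainTheorem5 {Ω : Type*} [MeasurableSpace Ω] (P : Measure Ω) [IsProbabilityMeasure P]
    (S : ℝ≥0 → Ω → ℝ) (hS : IsLevyProcess S P)
    -- `κ_S` is finite in a neighborhood of the origin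
    (hκ : (0 : ℝ) ∈ interior (integrableExpSet (S 1) P))
    (m q : ℝ) (hm : m = deriv (cgf (S 1) P) 0) (hq : q = iteratedDeriv 2 (cgf (S 1) P) 0)
    (ν : ℝ) (hν0 : 0 < ν) (hν1 : ν < 1)
    (L : ℝ≥0 → Ω → ℝ≥0) (hL : IsInverseStableSubordinator ν L P)
    -- the processes `S` and `L` are independent
    (hSL : IndepFun (fun ω (t : ℝ≥0) ↦ S t ω) (fun ω (t : ℝ≥0) ↦ L t ω) P) :
    -- `Y` is a copy of `L 1` on a probability space that also carries the normal variable `Z`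
    (m = 0 → ∀ {Ω' : Type*} [MeasurableSpace Ω'] (P' : Measure Ω') [IsProbabilityMeasure P']
      (Y : Ω' → ℝ≥0) (Z : Ω' → ℝ), IdentDistrib Y (L 1) P' P → HasLaw Z (gaussianReal 0 1) P' →
      IndepFun Y Z P' →
      TendstoInDistribution
        (fun (t : ℝ≥0) ω ↦ (t : ℝ) ^ scalingExponent ν m * (S (L t ω) ω / (t : ℝ))) atTop
        (fun ω' ↦ √(q * (Y ω' : ℝ)) * Z ω') (fun _ ↦ P) P') ∧
    (m ≠ 0 →
      TendstoInDistribution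
        (fun (t : ℝ≥0) ω ↦ (t : ℝ) ^ scalingExponent ν m * (S (L t ω) ω / (t : ℝ))) atTop
        (fun ω ↦ m * (L 1 ω : ℝ)) (fun _ ↦ P) P) := by
  have hS2 : MemLp (S 1) 2 P := memLp_of_mem_interior_integrableExpSet hκ 2
  have hmean : P[S 1] = m := by simp [hm, deriv_cgf_zero hκ]
  refine ⟨fun hm0 Ω' _ P' _ Y Z hY hZ hYZ ↦ ?_, fun hm0 ↦ ?_⟩
  · have hq' : q = P[S 1 ^ 2] := by
      rw [hq, iteratedDeriv_two_cgf hκ, ← hm, hm0]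
      simp
    have hq0 : 0 ≤ q := hq' ▸ integral_nonneg fun ω ↦ sq_nonneg _
    have hYm := hY.aemeasurable_fst
    have hZm := hZ.aemeasurable
    refine tendstoInDistribution_eval_inverseStableSubordinator hS hL hSL (β := ν / 2)
      (by fun_prop) (by rw [scalingExponent, if_pos hm0]; ring)
      (fun t ht u s ↦ hS.tendsto_charFun_map_of_integral_eq_zero hS2 (hmean.trans hm0) hν0 ht u s)
      fun u ↦ ?_
    rw [charFun_map_sqrt_mul_mul_gaussian hYm hZ hYZ hq0, hY.map_eq, hq']
  · have hLm := hL.aemeasurable 1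
    refine tendstoInDistribution_eval_inverseStableSubordinator hS hL hSL (β := ν)
      (by fun_prop) (by rw [scalingExponent, if_neg hm0]; ring)
      (fun t ht u s ↦ hS.tendsto_charFun_map_of_memLp_two hS2 hν0 ht u s) fun u ↦ ?_
    rw [charFun_apply_real, integral_map (by fun_prop) (by fun_prop),
      integral_map hLm (by fun_prop), hmean]
    congr with ω
    push_cast
    ring_nf
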